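/- Let $M$ be a smooth manifold, $\mathcal{O}_M=C^\infty(M)$ its ring of smooth functions and $T_{\mathcal{O}_M}=\mathrm{Der}_{\mathbb{R}}(\mathcal{O}_M)=\mathfrak{X}(M)$. Let $L_\infty/\mathcal{O}_M$ be the category of $L_\infty$-algebroids over $\mathcal{O}_M$. An object is a non-negatively graded $\mathcal{O}_M$-module $L$ with $\mathbb{R}$-multilinear graded antisymmetric brackets $[\,]_k$ ($k\ge 1$) of degree $k-2$ satisfying the higher Jacobi identities $$\sum_{i+j=k}(-1)^{ij}\sum_{\sigma\in S_{i,j}}\chi(\sigma,v)\,\bigl[[v_{\sigma(1)},\dots,v_{\sigma(i)}]_i,v_{\sigma(i+1)},\dots,v_{\sigma(k)}\bigr]_{j+1}=0$$ (for homogeneous $v_1,\dots,v_k$; $i\ge 1$, $j\ge 0$; $S_{i,j}$ the $(i,j)$-unshuffles and $\chi(\sigma,v)$ the antisymmetric Koszul sign), together with an $\mathcal{O}_M$-linear anchor $\rho\colon L\to T_{\mathcal{O}_M}$ of degree $0$ that is a strict morphism of $L_\infty$-algebras (to the Lie algebra $T_{\mathcal{O}_M}$ in degree $0$), such that $[v,aw]_2=a[v,w]_2+\rho(v)(a)\,w$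 for $a\in\mathcal{O}_M$ and such that, for $k\neq 2$, $[\,]_k$ is $\mathcal{O}_M$-linear in its last argument. Morphisms are the strict ones: degree-preserving $\mathcal{O}_M$-linear maps that preserve all brackets and the anchors. Equip $L_\infty/\mathcal{O}_M$ with the classes of Nuiten's semi-model structure: weak equivalences are the quasi-isomorphisms (with respect to the differential $[\,]_1$), fibrations are the maps that are surjective in all positive degrees, and cofibrations are the maps with the left lifting property with respect to the trivial fibrations (maps that are both fibrations and weak equivalences). A singular foliation $\mathcal{F}$ on $M$ is a locally finitely generated $\mathcal{O}_M$-submodule of $\mathfrak{X}(M)$ closed under the Lie bracket; it is regarded as an $L_\infty$-algebroid concentrated in degree $0$, with the commutator as its only nonzero bracket and the inclusion as its anchor. A cofibrant replacement of $\mathcal{F}$ is an object $Q$ such that the map $0\to \mathcal{F}$ from the initial object factors as a cofibration $0\to Q$ followed by a trivial fibration $Q\to\mathcal{F}$. A cylinder object of $Q$ is a factorization $Q\amalg Q\xrightarrow{i_0+i_1}\mathrm{Cyl}(Q)\xrightarrow{\sim}Q$ of the codiagonal whose second map is a weak equivalence (equivalently, a weak equivalence $\mathrm{Cyl}(Q)\to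 Q$ with two sections $i_0,i_1$), and $f,g\colon Q\to Q'$ are left homotopic if there are a cylinder object of $Q$ and a morphism $H\colon \mathrm{Cyl}(Q)\to Q'$ with $H i_0=f$ and $H i_1=g$. Theorem. Let $\mathcal{F}$ be a singular foliation on $M$ and let $Q,Q'$ be cofibrant replacements of $\mathcal{F}$ in $L_\infty/\mathcal{O}_M$. Then there is a quasi-isomorphism $Q\to Q'$ that is a strict morphism of $L_\infty$-algebroids, and any two strict morphisms $Q\to Q'$ that are quasi-isomorphisms are left homotopic. -/

import Mathlib

open CategoryTheory HomotopicalAlgebra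
open scoped Manifold ContDiff

universe w u₁ u₂

noncomputable section

/-- The Koszul sign `χ(σ, v)`, for homogeneous `v i` of degree `d i`, determined by
`v 0 ∧ ⋯ ∧ v (n-1) = χ(σ, v) v (σ 0) ∧ ⋯ ∧ v (σ (n-1))` where
`x ∧ y = -(-1)^(|x||y|) y ∧ x`: the product of the signs over all inversions of `σ`. -/
def koszulSign {n : ℕ} (σ : Equiv.Perm (Fin n)) (d : Fin n → ℕ) : ℤ :=
  ∏ p : Fin n × Fin n with p.1 < p.2 ∧ σ p.2 < σ p.1, -(-1) ^ (d (σ p.1) * d (σ p.2))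

/-- The `(i, n - i)`-unshuffles: permutations of `Fin n` that are increasing on the first `i`
and on the last `n - i` indices. -/
def unshuffles (n i : ℕ) : Finset (Equiv.Perm (Fin n)) :=
  {σ | ∀ a b : Fin n, a < b → ((b : ℕ) < i ∨ i ≤ (a : ℕ)) → σ a < σ b}

/-- An `L∞`-algebroid over the commutative `k`-algebra `A` (placed in degree `0`): a non-negatively
graded `A`-module `L = ⨁ grade n` with `k`-multilinear graded antisymmetric brackets of arity `n`
and degree `n - 2` that satisfy the higher Jacobi identities, together with an `A`-linear anchor of
degree `0` to the derivations of `A` which is a strict morphism of `L∞`-algebras and for which the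
brackets satisfy the Leibniz rules. (The bracket of arity `0` vanishes for degree reasons.) -/
structure LInftyAlgebroid (k : Type u₁) (A : Type u₂) [Field k] [CommRing A] [Algebra k A] where
  /-- the total space -/
  carrier : Type w
  [addCommGroup : AddCommGroup carrier]
  [baseModule : Module k carrier]
  [module : Module A carrier]
  [isScalarTower : IsScalarTower k A carrier]
  /-- the homogeneous elements of degree `n` -/
  grade : ℕ → Submodule A carrier
  isInternal : DirectSum.IsInternal grade
  /-- the multibracket of arity `n` -/
  bracket (n : ℕ) : MultilinearMap k (fun _ : Fin n => carrier) carrier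
  bracket_mem : ∀ (n : ℕ) (d : Fin n → ℕ) (v : Fin n → carrier), (∀ i, v i ∈ grade (d i)) →
    ∀ e : ℕ, e + 2 = n + ∑ i, d i → bracket n v ∈ grade e
  /-- a bracket whose degree would be negative is zero -/
  bracket_eq_zero : ∀ (n : ℕ) (d : Fin n → ℕ) (v : Fin n → carrier), (∀ i, v i ∈ grade (d i)) →
    n + ∑ i, d i < 2 → bracket n v = 0
  bracket_swap : ∀ (n : ℕ) (d : Fin n → ℕ) (v : Fin n → carrier), (∀ i, v i ∈ grade (d i)) →
    ∀ (i : ℕ) (hi : i + 1 < n),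
      bracket n v = (-(-1) ^ (d ⟨i, by omega⟩ * d ⟨i + 1, hi⟩) : ℤ) •
        bracket n (v ∘ Equiv.swap ⟨i, by omega⟩ ⟨i + 1, hi⟩)
  jacobi : ∀ (n : ℕ) (d : Fin n → ℕ) (v : Fin n → carrier), (∀ i, v i ∈ grade (d i)) →
    ∑ i : Fin (n + 1), (-1 : ℤ) ^ ((i : ℕ) * (n - i)) • ∑ σ ∈ unshuffles n i, koszulSign σ d •
      bracket (n - i + 1) (Fin.cons (bracket i fun a : Fin i => v (σ ⟨a, by omega⟩))
        fun b : Fin (n - i) => v (σ ⟨i + b, by omega⟩)) = 0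
  /-- the anchor -/
  anchor : carrier →ₗ[A] Derivation k A A
  anchor_grade : ∀ n : ℕ, 0 < n → ∀ x ∈ grade n, anchor x = 0
  anchor_bracket_one : ∀ v : Fin 1 → carrier, anchor (bracket 1 v) = 0
  anchor_bracket_two : ∀ v : Fin 2 → carrier, anchor (bracket 2 v) = ⁅anchor (v 0), anchor (v 1)⁆
  bracket_two_smul : ∀ (x y : carrier) (a : A),
    bracket 2 ![x, a • y] = a • bracket 2 ![x, y] + anchor x a • y
  bracket_smul : ∀ n : ℕ, n ≠ 1 → ∀ (v : Fin (n + 1) → carrier) (a : A),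
    bracket (n + 1) (Function.update v (Fin.last n) (a • v (Fin.last n))) = a • bracket (n + 1) v

namespace LInftyAlgebroid

attribute [instance] addCommGroup baseModule module isScalarTower

section Category

variable {k : Type u₁} {A : Type u₂} [Field k] [CommRing A] [Algebra k A]

/-- A strict morphism of `L∞`-algebroids over `A`: an `A`-linear map of degree `0` which preserves
all brackets and the anchors. -/
@[ext]
structure Hom (X Y : LInftyAlgebroid.{w} k A) where
  /-- the underlying linear map -/
  toLinearMap : X.carrier →ₗ[A] Y.carrier
  map_grade : ∀ (n : ℕ), ∀ x ∈ X.grade n, toLinearMap x ∈ Y.grade n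
  map_bracket : ∀ (n : ℕ) (v : Fin n → X.carrier),
    toLinearMap (X.bracket n v) = Y.bracket n fun i => toLinearMap (v i)
  map_anchor : ∀ x, Y.anchor (toLinearMap x) = X.anchor x

instance : Category (LInftyAlgebroid.{w} k A) where
  Hom := Hom
  id X :=
    { toLinearMap := LinearMap.id
      map_grade := fun _ _ h => h
      map_bracket := fun _ _ => rfl
      map_anchor := fun _ => rfl }
  comp f g :=
    { toLinearMap := g.toLinearMap ∘ₗ f.toLinearMap
      map_grade := fun n x h => g.map_grade n _ (f.map_grade n x h)
      map_bracket := fun n v => by simp [f.map_bracket, g.map_bracket]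
      map_anchor := fun x => by simp [f.map_anchor, g.map_anchor] }

/-- The differential `x ↦ [x]₁`. -/
def differential (X : LInftyAlgebroid.{w} k A) : X.carrier →ₗ[A] X.carrier where
  toFun x := X.bracket 1 fun _ => x
  map_add' x y := by
    have h := (X.bracket 1).map_update_add (fun _ => (0 : X.carrier)) 0 x y
    have e : ∀ z : X.carrier, Function.update (fun _ : Fin 1 => (0 : X.carrier)) 0 z
        = fun _ => z := fun z => by
      ext i
      simp [Subsingleton.elim i 0]
    simpa only [e] using h
  map_smul' a x := by
    have h := X.bracket_smul 0 (by decide) (fun _ => x) a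
    have e : Function.update (fun _ : Fin 1 => x) (Fin.last 0) (a • x) = fun _ => a • x := by
      ext i
      simp [Subsingleton.elim i (Fin.last 0)]
    rw [e] at h
    exact h

/-- The `n`-cycles of the underlying complex. -/
def cycles (X : LInftyAlgebroid.{w} k A) (n : ℕ) : Submodule A X.carrier :=
  X.grade n ⊓ LinearMap.ker X.differential

/-- The `n`-boundaries of the underlying complex. -/
def boundaries (X : LInftyAlgebroid.{w} k A) (n : ℕ) : Submodule A X.carrier :=
  (X.grade (n + 1)).map X.differential

/-- The `n`-th homology of the underlying complex. -/
abbrev homology (X : LInftyAlgebroid.{w} k A) (n : ℕ) : Type w :=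
  X.cycles n ⧸ (X.boundaries n).submoduleOf (X.cycles n)

theorem Hom.map_differential {X Y : LInftyAlgebroid.{w} k A} (f : Hom X Y) (x : X.carrier) :
    f.toLinearMap (X.differential x) = Y.differential (f.toLinearMap x) :=
  f.map_bracket 1 fun _ => x

/-- The map induced on `n`-cycles. -/
def Hom.cyclesMap {X Y : LInftyAlgebroid.{w} k A} (f : Hom X Y) (n : ℕ) :
    X.cycles n →ₗ[A] Y.cycles n :=
  f.toLinearMap.restrict fun x hx => ⟨f.map_grade n x hx.1, by
    have h : X.differential x = 0 := hx.2
    change Y.differential (f.toLinearMap x) = 0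
    rw [← f.map_differential, h, map_zero]⟩

/-- The map induced on the `n`-th homology. -/
def Hom.homologyMap {X Y : LInftyAlgebroid.{w} k A} (f : Hom X Y) (n : ℕ) :
    X.homology n →ₗ[A] Y.homology n :=
  Submodule.mapQ _ _ (f.cyclesMap n) <| by
    rintro ⟨x, hx⟩ ⟨y, hy, hxy⟩
    exact ⟨f.toLinearMap y, f.map_grade _ y hy, by
      rw [← f.map_differential, hxy]
      rfl⟩

/-- The weak equivalences are the quasi-isomorphisms. -/
instance : CategoryWithWeakEquivalences (LInftyAlgebroid.{w} k A) where
  weakEquivalences := fun _ _ (f : Hom _ _) => ∀ n : ℕ, Function.Bijective (f.homologyMap n)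

/-- The fibrations are the maps that are surjective in positive degrees. -/
instance : CategoryWithFibrations (LInftyAlgebroid.{w} k A) where
  fibrations := fun X Y (f : Hom X Y) =>
    ∀ n : ℕ, 0 < n → ∀ y ∈ Y.grade n, ∃ x ∈ X.grade n, f.toLinearMap x = y

/-- The cofibrations are the maps with the left lifting property with respect to all trivial
fibrations. -/
instance : CategoryWithCofibrations (LInftyAlgebroid.{w} k A) where
  cofibrations := (trivialFibrations (LInftyAlgebroid.{w} k A)).llp

variable (k A) in
/-- The zero `L∞`-algebroid. -/
def zero : LInftyAlgebroid.{w} k A where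
  carrier := PUnit
  grade _ := ⊥
  isInternal := by
    rw [DirectSum.isInternal_submodule_iff_iSupIndep_and_iSup_eq_top]
    exact ⟨fun _ => disjoint_bot_left, Subsingleton.elim _ _⟩
  bracket _ := 0
  bracket_mem _ _ _ _ _ _ := Subsingleton.elim _ _
  bracket_eq_zero _ _ _ _ _ := rfl
  bracket_swap _ _ _ _ _ _ := rfl
  jacobi _ _ _ _ := rfl
  anchor := 0
  anchor_grade _ _ _ _ := rfl
  anchor_bracket_one _ := rfl
  anchor_bracket_two _ := by simp
  bracket_two_smul _ _ _ := rfl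
  bracket_smul _ _ _ _ := rfl

variable (k A) in
/-- The zero `L∞`-algebroid is an initial object. -/
def zeroIsInitial : Limits.IsInitial (zero.{w} k A) :=
  Limits.IsInitial.ofUniqueHom
    (fun X => ({ toLinearMap := 0
                 map_grade := fun _ _ _ => Submodule.zero_mem _
                 map_bracket := fun n v => by
                  have h0 : (X.bracket n fun _ => (0 : X.carrier)) = 0 := by
                    rcases n with _ | n
                    · exact X.bracket_eq_zero 0 (fun _ => 0) _ (fun i => i.elim0) (by simp)
                    · exact (X.bracket (n + 1)).map_coord_zero 0 rfl
                  exact h0.symm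
                 map_anchor := fun _ => map_zero _ } : Hom _ _))
    (fun X (m : Hom _ _) => Hom.ext (LinearMap.ext fun x => map_zero m.toLinearMap))

instance : Limits.HasInitial (LInftyAlgebroid.{w} k A) :=
  (zeroIsInitial k A).hasInitial

/-- `Q` is a cofibrant replacement of `X`: the map from the initial object to `X` factors as a
cofibration `0 ⟶ Q` followed by a trivial fibration `Q ⟶ X`. -/
def IsCofibrantReplacement (Q X : LInftyAlgebroid.{w} k A) : Prop :=
  IsCofibrant Q ∧ ∃ p : Q ⟶ X, Fibration p ∧ WeakEquivalence p

end Category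

section LieRinehart

variable {k : Type u₁} {A : Type u₂} [Field k] [CommRing A] [Algebra k A]
  (N : Submodule A (Derivation k A A)) (hN : ∀ X ∈ N, ∀ Y ∈ N, ⁅X, Y⁆ ∈ N)

/-- The commutator of derivations as a multilinear map on `N`. -/
def commutatorMap : MultilinearMap k (fun _ : Fin 2 => N) N where
  toFun v := ⟨⁅(v 0 : Derivation k A A), (v 1 : Derivation k A A)⁆, hN _ (v 0).2 _ (v 1).2⟩
  map_update_add' v i x y := by
    fin_cases i <;> ext a <;> simp [Function.update, Derivation.commutator_apply]
  map_update_smul' v i c x := by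
    fin_cases i <;> ext a <;> simp [Function.update, Derivation.commutator_apply, smul_sub]

/-- The brackets of a dg-Lie algebra concentrated in degree `0`: only the binary one is nonzero. -/
def commutatorBracket : (n : ℕ) → MultilinearMap k (fun _ : Fin n => N) N
  | 2 => commutatorMap N hN
  | _ => 0

theorem commutatorBracket_of_ne {n : ℕ} (h : n ≠ 2) : commutatorBracket N hN n = 0 := by
  unfold commutatorBracket
  split
  · exact absurd rfl h
  · rfl

/-- An `A`-submodule of the derivations of `A` that is closed under the commutator, as an
`L∞`-algebroid concentrated in degree `0`, with the inclusion as its anchor. -/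
def ofDerivations : LInftyAlgebroid.{u₂} k A where
  carrier := N
  grade n := if n = 0 then ⊤ else ⊥
  isInternal := by
    rw [DirectSum.isInternal_submodule_iff_iSupIndep_and_iSup_eq_top]
    refine ⟨fun n => ?_, top_le_iff.1 (le_iSup_of_le 0 (by simp))⟩
    by_cases hn : n = 0
    · have : (⨆ (j : ℕ) (_ : j ≠ n), if j = 0 then (⊤ : Submodule A N) else ⊥) = ⊥ := by
        simp only [iSup_eq_bot]
        intro j hj
        rw [if_neg (by omega)]
      rw [this]
      exact disjoint_bot_right
    · simp [hn]
  bracket := commutatorBracket N hN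
  bracket_mem n d v hv e he := by
    by_cases hn : n = 2
    · subst hn
      by_cases h0 : ∃ i, d i ≠ 0
      · obtain ⟨i, hi⟩ := h0
        have := hv i
        rw [if_neg hi, Submodule.mem_bot] at this
        rw [MultilinearMap.map_coord_zero _ i this]
        exact Submodule.zero_mem _
      · push Not at h0
        have : e = 0 := by simp [h0] at he; omega
        simp [this]
    · simp [commutatorBracket_of_ne N hN hn]
  bracket_eq_zero n d v _ hd := by
    rw [commutatorBracket_of_ne N hN (by omega)]
    rfl
  bracket_swap n d v hv i hi := by
    by_cases hn : n = 2
    · subst hn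
      obtain rfl : i = 0 := by omega
      by_cases h0 : ∃ i, d i ≠ 0
      · obtain ⟨j, hj⟩ := h0
        have := hv j
        rw [if_neg hj, Submodule.mem_bot] at this
        rw [MultilinearMap.map_coord_zero _ j this, MultilinearMap.map_coord_zero _
          (Equiv.swap 0 1 j) (by simpa using this), smul_zero]
      · push Not at h0
        ext a
        simp [h0, commutatorBracket, commutatorMap, Derivation.commutator_apply]
    · simp [commutatorBracket_of_ne N hN hn]
  jacobi n d v hv := by
    by_cases hn : n = 3
    · subst hn
      by_cases h0 : ∃ j, d j ≠ 0
      · obtain ⟨j, hj⟩ := h0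
        have hvj := hv j
        rw [if_neg hj, Submodule.mem_bot] at hvj
        refine Finset.sum_eq_zero fun i _ => ?_
        rw [Finset.sum_eq_zero, smul_zero]
        intro σ _
        by_cases hji : ((σ.symm j : Fin 3) : ℕ) < i
        · rw [MultilinearMap.map_coord_zero _ 0, smul_zero]
          rw [Fin.cons_zero]
          exact MultilinearMap.map_coord_zero _ ⟨σ.symm j, hji⟩ (by simpa using hvj)
        · rw [MultilinearMap.map_coord_zero _ (Fin.succ ⟨σ.symm j - i, by omega⟩), smul_zero]
          rw [Fin.cons_succ]
          have e : (⟨(i : ℕ) + ((σ.symm j : ℕ) - i), by omega⟩ : Fin 3) = σ.symm j :=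
            Fin.ext (by dsimp; omega)
          simpa [e] using hvj
      · push Not at h0
        obtain rfl : d = fun _ => 0 := funext h0
        rw [Fin.sum_univ_four]
        have hu : unshuffles 3 2 = {1, Equiv.swap 1 2, finRotate 3} := by decide
        have h1 : koszulSign (1 : Equiv.Perm (Fin 3)) (fun _ => 0) = 1 := by decide
        have h2 : koszulSign (Equiv.swap 1 2 : Equiv.Perm (Fin 3)) (fun _ => 0) = -1 := by decide
        have h3 : koszulSign (finRotate 3) (fun _ => 0) = 1 := by decide
        have hi : ∀ i : Fin 4, (i : ℕ) ≠ 2 → ∑ σ ∈ unshuffles 3 i, koszulSign σ (fun _ => 0) •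
            commutatorBracket N hN (3 - i + 1) (Fin.cons
              (commutatorBracket N hN i fun a : Fin i => v (σ ⟨a, by omega⟩))
              fun b : Fin (3 - i) => v (σ ⟨i + b, by omega⟩)) = 0 := fun i hi => by
          refine Finset.sum_eq_zero fun σ _ => ?_
          rw [MultilinearMap.map_coord_zero _ 0, smul_zero]
          rw [Fin.cons_zero, commutatorBracket_of_ne N hN hi]
          rfl
        rw [hi 0 (by decide), hi 1 (by decide), hi 3 (by decide)]
        change (_ : ℤ) • 0 + (_ : ℤ) • 0 + (_ : ℤ) • (∑ σ ∈ unshuffles 3 2, koszulSign σ (fun _ => 0) • commutatorMap N hN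
          (Fin.cons (commutatorMap N hN fun a : Fin 2 => v (σ ⟨a, by omega⟩))
            fun b : Fin 1 => v (σ ⟨2 + b, by omega⟩))) + (_ : ℤ) • 0 = 0
        rw [hu, Finset.sum_insert (by decide), Finset.sum_insert (by decide),
          Finset.sum_singleton, h1, h2, h3]
        have r0 : finRotate 3 0 = 1 := by decide
        have r1 : finRotate 3 1 = 2 := by decide
        have r2 : finRotate 3 2 = 0 := by decide
        have s0 : Equiv.swap (1 : Fin 3) 2 0 = 0 := by decide
        apply Subtype.ext
        simp only [commutatorMap, MultilinearMap.coe_mk, Fin.cons_zero, Fin.cons_one]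
        simp [r0, r1, r2, s0]
        ext a
        simp only [Derivation.commutator_apply, Derivation.add_apply, Derivation.sub_apply,
          Derivation.zero_apply, map_sub]
        ring
    · refine Finset.sum_eq_zero fun i _ => ?_
      rw [Finset.sum_eq_zero, smul_zero]
      intro σ _
      by_cases hi : (i : ℕ) = 2
      · rw [commutatorBracket_of_ne N hN (n := n - i + 1) (by omega)]
        simp
      · rw [MultilinearMap.map_coord_zero _ 0, smul_zero]
        rw [Fin.cons_zero, commutatorBracket_of_ne N hN hi]
        rfl
  anchor := N.subtype
  anchor_grade n hn x hx := by
    rw [if_neg (by omega), Submodule.mem_bot] at hx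
    simp [hx]
  anchor_bracket_one _ := rfl
  anchor_bracket_two _ := rfl
  bracket_two_smul x y a := by
    ext b
    simp [commutatorBracket, commutatorMap, Derivation.commutator_apply]
  bracket_smul n hn v a := by
    rw [commutatorBracket_of_ne N hN (n := n + 1) (by omega)]
    simp

end LieRinehart

end LInftyAlgebroid

/-- A singular foliation on the smooth manifold `M`: a submodule of the `C^∞(M)`-module of vector
fields (derivations of `C^∞(M)`) that is closed under the Lie bracket and locally finitely
generated. -/
structure SingularFoliation (m : ℕ) (M : Type w) [TopologicalSpace M]
    [ChartedSpace (EuclideanSpace ℝ (Fin m)) M] where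
  /-- the underlying module of vector fields -/
  toSubmodule : Submodule C^∞⟮𝓡 m, M; ℝ⟯ (Derivation ℝ C^∞⟮𝓡 m, M; ℝ⟯ C^∞⟮𝓡 m, M; ℝ⟯)
  lie_mem : ∀ X ∈ toSubmodule, ∀ Y ∈ toSubmodule, ⁅X, Y⁆ ∈ toSubmodule
  /-- near each point finitely many elements `Y i` generate: on an open neighbourhood `U` every
  element of the foliation equals `∑ c i • Y i` with `c i` smooth on `U` -/
  locally_finitely_generated : ∀ x : M, ∃ U : Set M, IsOpen U ∧ x ∈ U ∧
    ∃ (r : ℕ) (Y : Fin r → Derivation ℝ C^∞⟮𝓡 m, M; ℝ⟯ C^∞⟮𝓡 m, M; ℝ⟯),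
      (∀ i, Y i ∈ toSubmodule) ∧
      ∀ X ∈ toSubmodule, ∃ c : Fin r → M → ℝ,
        (∀ i, ContMDiffOn (𝓡 m) 𝓘(ℝ, ℝ) ∞ (c i) U) ∧
        ∀ (g : C^∞⟮𝓡 m, M; ℝ⟯), ∀ y ∈ U, X g y = ∑ i, c i y * Y i g y

/-- A singular foliation as an `L∞`-algebroid over `C^∞(M)`. -/
def SingularFoliation.toLInftyAlgebroid {m : ℕ} {M : Type w} [TopologicalSpace M]
    [ChartedSpace (EuclideanSpace ℝ (Fin m)) M] (F : SingularFoliation m M) :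
    LInftyAlgebroid.{w} ℝ C^∞⟮𝓡 m, M; ℝ⟯ :=
  LInftyAlgebroid.ofDerivations F.toSubmodule F.lie_mem

end

/-! The anchor of a foliation is an inclusion of vector fields, and strict morphisms preserve
anchors; so any object has at most one morphism to `F` (`hom_ext_of_anchor_injective`). Let `p : Q ⟶
F` and `q : Q' ⟶ F` be the given resolutions. Existence: cofibrancy of `Q` lifts `p` through the
trivial fibration `q`, and two-out-of-three makes the lift a quasi-isomorphism. Homotopy: for `f g :
Q ⟶ Q'` the composites with `q` coincide by uniqueness. The fibre product of this common composite
with `q` is a cylinder on `Q`: its projection to `Q` is a base change of a trivial fibration, hence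
a quasi-isomorphism (`pullback.weakEquivalence_fst`), the graphs of `f` and `g` are two sections,
and the projection to `Q'` is the homotopy. The work lies in building the fibre product and checking
the base change by diagram chasing. -/

namespace LInftyAlgebroid

variable {k : Type u₁} {A : Type u₂} [Field k] [CommRing A] [Algebra k A]

/-! ### The underlying complex and homogeneous decompositions -/

theorem differential_mem_grade (X : LInftyAlgebroid.{w} k A) {n : ℕ} {x : X.carrier}
    (hx : x ∈ X.grade (n + 1)) : X.differential x ∈ X.grade n :=
  X.bracket_mem 1 (fun _ => n + 1) (fun _ => x) (fun _ => hx) n (by simp; omega)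

theorem differential_eq_zero_of_mem_grade_zero (X : LInftyAlgebroid.{w} k A) {x : X.carrier}
    (hx : x ∈ X.grade 0) : X.differential x = 0 :=
  X.bracket_eq_zero 1 (fun _ => 0) (fun _ => x) (fun _ => hx) (by simp)

/-- This is the Jacobi identity of arity one: its `i = 0` term contains the nullary bracket, which
vanishes since its degree would be `-2`. -/
theorem differential_differential (X : LInftyAlgebroid.{w} k A) {n : ℕ} {x : X.carrier}
    (hx : x ∈ X.grade n) : X.differential (X.differential x) = 0 := by
  have h := X.jacobi 1 (fun _ => n) (fun _ => x) fun _ => hx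
  have h0 : ∀ v : Fin 0 → X.carrier, X.bracket 0 v = 0 := fun v =>
    X.bracket_eq_zero 0 (fun _ => 0) v (fun i => i.elim0) (by simp)
  have hu : unshuffles 1 1 = {1} := by decide
  have hk : koszulSign (1 : Equiv.Perm (Fin 1)) (fun _ => n) = 1 := by
    rw [koszulSign, Finset.filter_false_of_mem, Finset.prod_empty]
    exact fun p _ hp => lt_asymm hp.1 hp.2
  rw [Fin.sum_univ_two, Finset.sum_eq_zero (s := unshuffles 1 ((0 : Fin 2) : ℕ)), smul_zero,
    zero_add] at h
  · change (_ : ℤ) • ∑ σ ∈ unshuffles 1 1, koszulSign σ (fun _ => n) • X.bracket 1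
      (Fin.cons (X.bracket 1 fun _ => x) fun _ : Fin 0 => x) = 0 at h
    rw [hu, Finset.sum_singleton, hk] at h
    have e : (Fin.cons (X.bracket 1 fun _ => x) fun _ : Fin 0 => x : Fin 1 → X.carrier)
        = fun _ => X.differential x := by
      ext i
      obtain rfl : i = (0 : Fin 1) := Subsingleton.elim (α := Fin 1) _ _
      rfl
    rw [e, one_smul] at h
    simp only [Fin.val_one, Nat.sub_self, mul_zero, pow_zero, one_smul] at h
    exact h
  · intro σ _
    rw [MultilinearMap.map_coord_zero _ 0, smul_zero]
    exact h0 _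

/-- Asking for every large `M`, not just one, lets two elements be decomposed over a common range.
-/
theorem exists_sum_range (X : LInftyAlgebroid.{w} k A) (x : X.carrier) :
    ∃ c : ℕ → X.carrier, (∀ n, c n ∈ X.grade n) ∧
      ∃ N, ∀ M ≥ N, ∑ n ∈ Finset.range M, c n = x := by
  have hx : x ∈ ⨆ n, X.grade n := by
    rw [X.isInternal.submodule_iSup_eq_top]
    trivial
  induction hx using Submodule.iSup_induction' with
  | mem n x hx =>
    refine ⟨Pi.single n x, fun i => ?_, n + 1, fun M hM => ?_⟩
    · by_cases h : i = n
      · subst h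
        simpa using hx
      · simp [h]
    · rw [Finset.sum_pi_single', if_pos (Finset.mem_range.2 (by omega))]
  | zero => exact ⟨0, fun n => Submodule.zero_mem _, 0, fun M _ => by simp⟩
  | add x y _ _ hx hy =>
    obtain ⟨c, hc, N, hN⟩ := hx
    obtain ⟨c', hc', N', hN'⟩ := hy
    refine ⟨c + c', fun n => Submodule.add_mem _ (hc n) (hc' n), max N N', fun M hM => ?_⟩
    simp only [Pi.add_apply, Finset.sum_add_distrib]
    rw [hN M (le_trans (le_max_left _ _) hM), hN' M (le_trans (le_max_right _ _) hM)]

/-! ### Homology in terms of elements, and trivial fibrations -/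

section Homology

variable {X Y Z : LInftyAlgebroid.{w} k A}

theorem Hom.homologyMap_injective_iff (f : Hom X Y) (n : ℕ) :
    Function.Injective (f.homologyMap n) ↔
      ∀ x ∈ X.cycles n, f.toLinearMap x ∈ Y.boundaries n → x ∈ X.boundaries n := by
  rw [injective_iff_map_eq_zero]
  constructor
  · intro h x hx hfx
    have := h (Submodule.Quotient.mk ⟨x, hx⟩)
      ((Submodule.Quotient.mk_eq_zero _).2 (show f.cyclesMap n ⟨x, hx⟩ ∈ _ from hfx))
    exact (Submodule.Quotient.mk_eq_zero ((X.boundaries n).submoduleOf (X.cycles n))).1 this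
  · intro h x hx
    obtain ⟨⟨x, hxc⟩, rfl⟩ := Submodule.Quotient.mk_surjective _ x
    exact (Submodule.Quotient.mk_eq_zero _).2
      (h x hxc ((Submodule.Quotient.mk_eq_zero
        ((Y.boundaries n).submoduleOf (Y.cycles n)) (x := f.cyclesMap n ⟨x, hxc⟩)).1 hx))

theorem Hom.homologyMap_surjective_iff (f : Hom X Y) (n : ℕ) :
    Function.Surjective (f.homologyMap n) ↔
      ∀ y ∈ Y.cycles n, ∃ x ∈ X.cycles n, f.toLinearMap x - y ∈ Y.boundaries n := by
  constructor
  · intro h y hy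
    obtain ⟨x, hx⟩ := h (Submodule.Quotient.mk ⟨y, hy⟩)
    obtain ⟨⟨x, hxc⟩, rfl⟩ := Submodule.Quotient.mk_surjective _ x
    exact ⟨x, hxc, (Submodule.Quotient.eq ((Y.boundaries n).submoduleOf (Y.cycles n))
      (x := f.cyclesMap n ⟨x, hxc⟩) (y := ⟨y, hy⟩)).1 hx⟩
  · intro h y
    obtain ⟨⟨y, hy⟩, rfl⟩ := Submodule.Quotient.mk_surjective _ y
    obtain ⟨x, hx, hxy⟩ := h y hy
    exact ⟨Submodule.Quotient.mk ⟨x, hx⟩, (Submodule.Quotient.eq _).2 hxy⟩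

theorem homologyMap_comp (f : X ⟶ Y) (g : Y ⟶ Z) (n : ℕ) :
    ⇑(Hom.homologyMap (f ≫ g) n) = Hom.homologyMap g n ∘ Hom.homologyMap f n := by
  ext x
  obtain ⟨x, rfl⟩ := Submodule.Quotient.mk_surjective _ x
  rfl

theorem weakEquivalence_iff_homologyMap (f : X ⟶ Y) :
    WeakEquivalence f ↔ ∀ n, Function.Bijective (Hom.homologyMap f n) :=
  weakEquivalence_iff f

theorem fibration_iff_surjective (f : X ⟶ Y) :
    Fibration f ↔ ∀ n : ℕ, 0 < n → ∀ y ∈ Y.grade n, ∃ x ∈ X.grade n, Hom.toLinearMap f x = y :=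
  fibration_iff f

theorem weakEquivalence_of_postcomp (f : X ⟶ Y) (g : Y ⟶ Z) (hg : WeakEquivalence g)
    (hfg : WeakEquivalence (f ≫ g)) : WeakEquivalence f := by
  rw [weakEquivalence_iff_homologyMap] at *
  intro n
  have h := hfg n
  rw [homologyMap_comp] at h
  exact (Function.Bijective.of_comp_iff' (hg n) _).1 h

/-- A trivial fibration is surjective on cycles. -/
theorem exists_cycle_map_eq (q : Y ⟶ Z) (hf : Fibration q) (hw : WeakEquivalence q) {n : ℕ}
    {z : Z.carrier} (hz : z ∈ Z.cycles n) : ∃ y ∈ Y.cycles n, Hom.toLinearMap q y = z := by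
  rw [fibration_iff_surjective] at hf
  rw [weakEquivalence_iff_homologyMap] at hw
  -- Surjectivity on homology gives `q y - z = d w`. Since `w` has degree `n + 1 > 0`, it lifts to
  -- `u` even when `n = 0`, and `y - d u` is a cycle over `z`.
  obtain ⟨y, hy, w, hw', hyw⟩ := (Hom.homologyMap_surjective_iff _ n).1 (hw n).2 z hz
  obtain ⟨u, hu, rfl⟩ := hf (n + 1) (by omega) w hw'
  refine ⟨y - Y.differential u, ⟨Submodule.sub_mem _ hy.1 (Y.differential_mem_grade hu), ?_⟩, ?_⟩
  · exact Submodule.sub_mem _ hy.2 (Y.differential_differential hu)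
  · rw [map_sub, Hom.map_differential, hyw]
    abel

/-- A trivial fibration is surjective in all degrees. -/
theorem exists_mem_grade_map_eq (q : Y ⟶ Z) (hf : Fibration q) (hw : WeakEquivalence q) {n : ℕ}
    {z : Z.carrier} (hz : z ∈ Z.grade n) : ∃ y ∈ Y.grade n, Hom.toLinearMap q y = z := by
  rcases Nat.eq_zero_or_pos n with rfl | hn
  -- Fibrations promise nothing in degree `0`, but there every element is a cycle.
  · obtain ⟨y, hy, h⟩ := exists_cycle_map_eq q hf hw
      ⟨hz, Z.differential_eq_zero_of_mem_grade_zero hz⟩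
    exact ⟨y, hy.1, h⟩
  · exact (fibration_iff_surjective q).1 hf n hn z hz

/-- The kernel of a trivial fibration is acyclic. -/
theorem exists_differential_eq_of_map_eq_zero (q : Y ⟶ Z) (hf : Fibration q)
    (hw : WeakEquivalence q) {n : ℕ} {y : Y.carrier} (hy : y ∈ Y.cycles n)
    (hqy : Hom.toLinearMap q y = 0) :
    ∃ u ∈ Y.grade (n + 1), Y.differential u = y ∧ Hom.toLinearMap q u = 0 := by
  have hinj := (Hom.homologyMap_injective_iff _ n).1 ((weakEquivalence_iff_homologyMap q).1 hw n).1
  obtain ⟨u, hu, rfl⟩ := hinj y hy (hqy ▸ Submodule.zero_mem _)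
  -- `q u` need not vanish, but it is a cycle; subtracting a cycle over it from `u` leaves `d u`
  -- unchanged.
  obtain ⟨u', hu', h⟩ := exists_cycle_map_eq q hf hw (n := n + 1) (z := Hom.toLinearMap q u)
    ⟨Hom.map_grade q _ u hu, by
      rwa [SetLike.mem_coe, LinearMap.mem_ker, ← Hom.map_differential]⟩
  refine ⟨u - u', Submodule.sub_mem _ hu hu'.1, ?_, ?_⟩
  · rw [map_sub, LinearMap.mem_ker.1 hu'.2, sub_zero]
  · rw [map_sub, h, sub_self]

end Homology

/-! ### Fibre products and the cylinder -/

section Pullback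

variable {X Y Z : LInftyAlgebroid.{w} k A} (p : X ⟶ Z) (q : Y ⟶ Z)

/-- The underlying module of the fibre product of `p` and `q`. -/
abbrev pullbackModule : Submodule A (X.carrier × Y.carrier) :=
  LinearMap.eqLocus (Hom.toLinearMap p ∘ₗ LinearMap.fst A X.carrier Y.carrier)
    (Hom.toLinearMap q ∘ₗ LinearMap.snd A X.carrier Y.carrier)

/-- The first projection on the underlying modules. -/
def pullbackFst : pullbackModule p q →ₗ[A] X.carrier :=
  LinearMap.fst A X.carrier Y.carrier ∘ₗ (pullbackModule p q).subtype

/-- The second projection on the underlying modules. -/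
def pullbackSnd : pullbackModule p q →ₗ[A] Y.carrier :=
  LinearMap.snd A X.carrier Y.carrier ∘ₗ (pullbackModule p q).subtype

theorem map_pullbackFst (z : pullbackModule p q) :
    Hom.toLinearMap p (pullbackFst p q z) = Hom.toLinearMap q (pullbackSnd p q z) := z.2

/-- Hence the anchor read off from `X` also serves the Leibniz rule in the `Y` component and makes
the second projection a morphism. -/
theorem anchor_pullbackFst (z : pullbackModule p q) :
    X.anchor (pullbackFst p q z) = Y.anchor (pullbackSnd p q z) := by
  rw [← Hom.map_anchor p, ← Hom.map_anchor q, map_pullbackFst]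

variable {p q} in
theorem pullback_ext {z z' : pullbackModule p q} (h₁ : pullbackFst p q z = pullbackFst p q z')
    (h₂ : pullbackSnd p q z = pullbackSnd p q z') : z = z' :=
  Subtype.ext (Prod.ext h₁ h₂)

/-- The homogeneous elements of the fibre product. -/
def pullbackGrade (n : ℕ) : Submodule A (pullbackModule p q) :=
  (X.grade n).comap (pullbackFst p q) ⊓ (Y.grade n).comap (pullbackSnd p q)

/-- Independence is checked in each component. For spanning, the homogeneous parts of the two
components must have equal images in `Z` degree by degree, which follows from independence of the
grading of `Z`. -/
theorem pullbackGrade_isInternal : DirectSum.IsInternal (pullbackGrade p q) := by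
  refine DirectSum.isInternal_submodule_of_iSupIndep_of_iSup_eq_top ?_ ?_
  · have hX := (iSupIndep_iff_finsetSum_eq_zero_imp_eq_zero _).1 X.isInternal.submodule_iSupIndep
    have hY := (iSupIndep_iff_finsetSum_eq_zero_imp_eq_zero _).1 Y.isInternal.submodule_iSupIndep
    refine (iSupIndep_iff_finsetSum_eq_zero_imp_eq_zero _).2 fun s v hv h i hi => ?_
    refine pullback_ext ?_ ?_
    · exact hX s (fun i => pullbackFst p q (v i)) (fun i hi => (hv i hi).1)
        (by rw [← map_sum, h, map_zero]) i hi
    · exact hY s (fun i => pullbackSnd p q (v i)) (fun i hi => (hv i hi).2)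
        (by rw [← map_sum, h, map_zero]) i hi
  · refine Submodule.eq_top_iff'.2 fun z => ?_
    obtain ⟨c, hc, N, hN⟩ := X.exists_sum_range (pullbackFst p q z)
    obtain ⟨c', hc', N', hN'⟩ := Y.exists_sum_range (pullbackSnd p q z)
    have hc_eq := hN (max N N') (le_max_left _ _)
    have hc'_eq := hN' (max N N') (le_max_right _ _)
    -- The differences `p (c i) - q (c' i)` have degree `i` and sum to zero, so each one vanishes.
    have hZ := (iSupIndep_iff_finsetSum_eq_zero_imp_eq_zero _).1 Z.isInternal.submodule_iSupIndep
      (Finset.range (max N N')) (fun i => Hom.toLinearMap p (c i) - Hom.toLinearMap q (c' i))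
      (fun i _ => Submodule.sub_mem _ (Hom.map_grade p i _ (hc i)) (Hom.map_grade q i _ (hc' i)))
      (by rw [Finset.sum_sub_distrib, ← map_sum, ← map_sum, hc_eq, hc'_eq, map_pullbackFst,
            sub_self])
    have hz : z = ∑ i : Finset.range (max N N'),
        (⟨(c i, c' i), sub_eq_zero.1 (hZ i i.2)⟩ : pullbackModule p q) := by
      refine pullback_ext ?_ ?_
      · rw [map_sum, ← hc_eq, ← Finset.sum_coe_sort]
        rfl
      · rw [map_sum, ← hc'_eq, ← Finset.sum_coe_sort]
        rfl
    rw [hz]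
    exact Submodule.sum_mem _ fun i _ =>
      Submodule.mem_iSup_of_mem (p := pullbackGrade p q) (i : ℕ) ⟨hc i, hc' i⟩

/-- The componentwise brackets of the fibre product. -/
def pullbackBracket (n : ℕ) :
    MultilinearMap k (fun _ : Fin n => pullbackModule p q) (pullbackModule p q) :=
  (((X.bracket n).compLinearMap fun _ => (pullbackFst p q).restrictScalars k).prod
    ((Y.bracket n).compLinearMap fun _ => (pullbackSnd p q).restrictScalars k)).codRestrict
      ((pullbackModule p q).restrictScalars k) fun v => by
        change Hom.toLinearMap p (X.bracket n _) = Hom.toLinearMap q (Y.bracket n _)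
        rw [Hom.map_bracket, Hom.map_bracket]
        exact congrArg _ (funext fun i => map_pullbackFst p q (v i))

theorem pullbackFst_bracket (n : ℕ) (v : Fin n → pullbackModule p q) :
    pullbackFst p q (pullbackBracket p q n v) = X.bracket n fun i => pullbackFst p q (v i) := rfl

theorem pullbackSnd_bracket (n : ℕ) (v : Fin n → pullbackModule p q) :
    pullbackSnd p q (pullbackBracket p q n v) = Y.bracket n fun i => pullbackSnd p q (v i) := rfl

/-- A linear map compatible with brackets sends the left hand side of the Jacobi identity to zero
if it holds in the target. -/
theorem map_jacobi_eq_zero {V : Type*} [AddCommGroup V] [Module k V] [Module A V]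
    (b : (n : ℕ) → MultilinearMap k (fun _ : Fin n => V) V) (W : LInftyAlgebroid.{w} k A)
    (φ : V →ₗ[A] W.carrier) (hφ : ∀ n v, φ (b n v) = W.bracket n fun i => φ (v i)) (n : ℕ)
    (d : Fin n → ℕ) (v : Fin n → V) (hv : ∀ i, φ (v i) ∈ W.grade (d i)) :
    φ (∑ i : Fin (n + 1), (-1 : ℤ) ^ ((i : ℕ) * (n - i)) • ∑ σ ∈ unshuffles n i, koszulSign σ d •
      b (n - i + 1) (Fin.cons (b i fun a : Fin i => v (σ ⟨a, by omega⟩))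
        fun c : Fin (n - i) => v (σ ⟨i + c, by omega⟩))) = 0 := by
  rw [← W.jacobi n d (fun i => φ (v i)) hv]
  simp only [map_sum, map_zsmul, hφ]
  refine Finset.sum_congr rfl fun i _ => congrArg _ (Finset.sum_congr rfl fun σ _ =>
    congrArg _ (congrArg _ (funext fun j => ?_)))
  -- Slot `0` holds the inner bracket, which needs `hφ` once more.
  refine Fin.cases ?_ (fun j => ?_) j
  · simp only [Fin.cons_zero, hφ]
  · simp only [Fin.cons_succ]

/-- The fibre product of `L∞`-algebroids. -/
def pullback : LInftyAlgebroid.{w} k A where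
  carrier := pullbackModule p q
  grade := pullbackGrade p q
  isInternal := pullbackGrade_isInternal p q
  bracket := pullbackBracket p q
  bracket_mem n d v hv e he :=
    ⟨X.bracket_mem n d _ (fun i => (hv i).1) e he, Y.bracket_mem n d _ (fun i => (hv i).2) e he⟩
  bracket_eq_zero n d v hv h :=
    pullback_ext (X.bracket_eq_zero n d _ (fun i => (hv i).1) h)
      (Y.bracket_eq_zero n d _ (fun i => (hv i).2) h)
  bracket_swap n d v hv i hi :=
    pullback_ext
      (by rw [map_zsmul]; exact X.bracket_swap n d _ (fun i => (hv i).1) i hi)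
      (by rw [map_zsmul]; exact Y.bracket_swap n d _ (fun i => (hv i).2) i hi)
  -- The two projections preserve brackets and are jointly injective, so the identity can be tested
  -- in `X` and `Y`.
  jacobi n d v hv :=
    pullback_ext
      (map_jacobi_eq_zero (pullbackBracket p q) X (pullbackFst p q) (pullbackFst_bracket p q) n d v
        fun i => (hv i).1)
      (map_jacobi_eq_zero (pullbackBracket p q) Y (pullbackSnd p q) (pullbackSnd_bracket p q) n d v
        fun i => (hv i).2)
  anchor := X.anchor ∘ₗ pullbackFst p q
  anchor_grade n hn x hx := X.anchor_grade n hn _ hx.1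
  anchor_bracket_one _ := X.anchor_bracket_one _
  anchor_bracket_two _ := X.anchor_bracket_two _
  bracket_two_smul x y a := by
    have e : ∀ {V W : Type w} (φ : V → W) (s t : V), (fun i => φ (![s, t] i)) = ![φ s, φ t] :=
      fun φ s t => funext fun i => by fin_cases i <;> rfl
    refine pullback_ext ?_ ?_
    · simp only [map_add, map_smul, pullbackFst_bracket, e, LinearMap.comp_apply]
      exact X.bracket_two_smul _ _ a
    · simp only [map_add, map_smul, pullbackSnd_bracket, e, LinearMap.comp_apply,
        anchor_pullbackFst]
      exact Y.bracket_two_smul _ _ a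
  bracket_smul n hn v a := by
    have e : ∀ {W : Type w} [AddCommGroup W] [Module A W] (φ : pullbackModule p q →ₗ[A] W),
        (fun i => φ (Function.update v (Fin.last n) (a • v (Fin.last n)) i)) =
          Function.update (fun i => φ (v i)) (Fin.last n) (a • φ (v (Fin.last n))) :=
      fun φ => by
        rw [← map_smul]
        exact funext fun i => Function.apply_update (fun _ => φ) _ _ _ _
    refine pullback_ext ?_ ?_
    · rw [map_smul, pullbackFst_bracket, pullbackFst_bracket, e]
      exact X.bracket_smul n hn _ a
    · rw [map_smul, pullbackSnd_bracket, pullbackSnd_bracket, e]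
      exact Y.bracket_smul n hn _ a

/-- The first projection of the fibre product. -/
def pullback.fst : pullback p q ⟶ X :=
  ({ toLinearMap := pullbackFst p q
     map_grade := fun _ _ h => And.left h
     map_bracket := pullbackFst_bracket p q
     map_anchor := fun _ => rfl } : Hom (pullback p q) X)

/-- The second projection of the fibre product. -/
def pullback.snd : pullback p q ⟶ Y :=
  ({ toLinearMap := pullbackSnd p q
     map_grade := fun _ _ h => And.right h
     map_bracket := pullbackSnd_bracket p q
     map_anchor := fun z => (anchor_pullbackFst p q z).symm } : Hom (pullback p q) Y)

variable {p q} in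
/-- The morphism to the fibre product induced by a commutative square. -/
def pullback.lift {W : LInftyAlgebroid.{w} k A} (f : W ⟶ X) (g : W ⟶ Y) (h : f ≫ p = g ≫ q) :
    W ⟶ pullback p q :=
  ({ toLinearMap := ((Hom.toLinearMap f).prod (Hom.toLinearMap g)).codRestrict
      (pullbackModule p q) fun x => LinearMap.congr_fun (congrArg Hom.toLinearMap h) x
     map_grade := fun n x hx => ⟨Hom.map_grade f n x hx, Hom.map_grade g n x hx⟩
     map_bracket := fun n v =>
      pullback_ext (p := p) (q := q) (Hom.map_bracket f n v) (Hom.map_bracket g n v)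
     map_anchor := Hom.map_anchor f } : Hom W (pullback p q))

/-- The base change of a trivial fibration is a weak equivalence. -/
theorem pullback.weakEquivalence_fst (hf : Fibration q) (hw : WeakEquivalence q) :
    WeakEquivalence (pullback.fst p q) := by
  rw [weakEquivalence_iff_homologyMap]
  refine fun n => ⟨(Hom.homologyMap_injective_iff _ n).2 ?_,
    (Hom.homologyMap_surjective_iff _ n).2 ?_⟩
  · rintro z ⟨hz, hdz⟩ ⟨u, hu, hdu⟩
    have hdu : X.differential u = pullbackFst p q z := hdu
    have hdy : Y.differential (pullbackSnd p q z) = 0 := by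
      have := Hom.map_differential (pullback.snd p q) z
      rw [LinearMap.mem_ker.1 hdz, map_zero] at this
      exact this.symm
    -- The first component of `z` is `d u`. A lift `v` of `p u` bounds the second component up to a
    -- cycle in the kernel of `q`; that cycle is `d v'` with `q v' = 0`, so `(u, v + v')` lies in
    -- the fibre product and bounds `z`.
    obtain ⟨v, hv, hqv⟩ := exists_mem_grade_map_eq q hf hw (Hom.map_grade p _ u hu)
    obtain ⟨v', hv', hdv', hqv'⟩ := exists_differential_eq_of_map_eq_zero q hf hw (n := n)
      (y := pullbackSnd p q z - Y.differential v)
      ⟨Submodule.sub_mem _ hz.2 (Y.differential_mem_grade hv), by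
        rw [SetLike.mem_coe, LinearMap.mem_ker, map_sub, hdy, Y.differential_differential hv, sub_zero]⟩
      (by rw [map_sub, Hom.map_differential, hqv, ← Hom.map_differential, hdu, sub_eq_zero]
          exact (map_pullbackFst p q z).symm)
    refine ⟨(⟨(u, v + v'), ?_⟩ : pullbackModule p q), ⟨hu, Submodule.add_mem _ hv hv'⟩,
      pullback_ext (p := p) (q := q) hdu ?_⟩
    · change Hom.toLinearMap p u = Hom.toLinearMap q (v + v')
      rw [map_add, hqv, hqv', add_zero]
    · change Y.differential (v + v') = pullbackSnd p q z
      rw [map_add, hdv']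
      abel
  · rintro x ⟨hx, hdx⟩
    -- Lifting `p x` to a cycle, not merely to an element, makes `(x, y)` a cycle lying exactly over
    -- `x`.
    obtain ⟨y, ⟨hy, hdy⟩, hqy⟩ := exists_cycle_map_eq q hf hw (n := n)
      (z := Hom.toLinearMap p x) ⟨Hom.map_grade p n x hx, by
        rw [SetLike.mem_coe, LinearMap.mem_ker, ← Hom.map_differential, LinearMap.mem_ker.1 hdx, map_zero]⟩
    refine ⟨(⟨(x, y), hqy.symm⟩ : pullbackModule p q), ⟨⟨hx, hy⟩,
      pullback_ext (p := p) (q := q) hdx hdy⟩, ?_⟩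
    change x - x ∈ _
    rw [sub_self]
    exact Submodule.zero_mem _

/-- Morphisms that agree after composition with a trivial fibration `q` are left homotopic: the
fibre product of `q` with the common composite is a cylinder object. -/
theorem leftHomotopyRel_of_comp_eq (f g : X ⟶ Y) (hf : Fibration q) (hw : WeakEquivalence q)
    (h : f ≫ q = g ≫ q) : LeftHomotopyRel f g :=
  ⟨{ I := pullback (f ≫ q) q
     -- The sections are the graphs of `f` and `g`; the hypothesis `h` puts the second graph in the
     -- same fibre product.
     i₀ := pullback.lift (𝟙 X) f (Category.id_comp _)
     i₁ := pullback.lift (𝟙 X) g ((Category.id_comp _).trans h)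
     π := pullback.fst (f ≫ q) q
     i₀_π := rfl
     i₁_π := rfl
     weakEquivalence_π := pullback.weakEquivalence_fst _ q hf hw },
   ⟨{ h := pullback.snd (f ≫ q) q
      h₀ := rfl
      h₁ := rfl }⟩⟩

end Pullback

/-! ### Uniqueness of maps to the foliation, lifting, and the theorem -/

/-- A morphism to an `L∞`-algebroid with injective anchor is unique. -/
theorem hom_ext_of_anchor_injective {X Y : LInftyAlgebroid.{w} k A}
    (hY : Function.Injective Y.anchor) (f g : X ⟶ Y) : f = g :=
  Hom.ext (LinearMap.ext fun x => hY ((Hom.map_anchor f x).trans (Hom.map_anchor g x).symm))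

/-- Cofibrations are defined by lifting against trivial fibrations, and a square starting at the
initial object commutes automatically. -/
theorem exists_comp_eq_of_isCofibrant {Q Y Z : LInftyAlgebroid.{w} k A} (hQ : IsCofibrant Q)
    (p : Q ⟶ Z) (q : Y ⟶ Z) (hf : Fibration q) (hw : WeakEquivalence q) :
    ∃ f : Q ⟶ Y, f ≫ q = p := by
  have : HasLiftingProperty (Limits.initial.to Q) q := hQ.mem q ⟨hf.mem, hw.mem⟩
  have sq : CommSq (Limits.initial.to Y) (Limits.initial.to Q) q p :=
    ⟨Limits.initial.hom_ext _ _⟩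
  exact ⟨sq.lift, sq.fac_right⟩

end LInftyAlgebroid

theorem theorem4 {m : ℕ} {M : Type w} [TopologicalSpace M] [T2Space M] [ParacompactSpace M]
    [ChartedSpace (EuclideanSpace ℝ (Fin m)) M] [IsManifold (𝓡 m) ∞ M]
    (F : SingularFoliation m M) (Q Q' : LInftyAlgebroid.{w} ℝ C^∞⟮𝓡 m, M; ℝ⟯)
    (hQ : LInftyAlgebroid.IsCofibrantReplacement Q F.toLInftyAlgebroid)
    (hQ' : LInftyAlgebroid.IsCofibrantReplacement Q' F.toLInftyAlgebroid) :
    (∃ f : Q ⟶ Q', WeakEquivalence f) ∧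
      ∀ f g : Q ⟶ Q', WeakEquivalence f → WeakEquivalence g → LeftHomotopyRel f g := by
  obtain ⟨hcof, p, -, hp⟩ := hQ
  obtain ⟨-, q, hqf, hqw⟩ := hQ'
  refine ⟨?_, fun f g _ _ => ?_⟩
  · obtain ⟨f, hf⟩ := LInftyAlgebroid.exists_comp_eq_of_isCofibrant hcof p q hqf hqw
    exact ⟨f, LInftyAlgebroid.weakEquivalence_of_postcomp f q hqw (hf ▸ hp)⟩
  -- The composites `f ≫ q` and `g ≫ q` agree because the anchor of the foliation is the inclusion
  -- of a submodule.
  · exact LInftyAlgebroid.leftHomotopyRel_of_comp_eq q f g hqf hqw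
      (LInftyAlgebroid.hom_ext_of_anchor_injective F.toSubmodule.injective_subtype _ _)
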